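/- Let $X$ be a finite complex: finite sets $X_0,\dots,X_d$ of cells (with $X_k=\emptyset$ for $k>d$), chain groups $C_k=\mathbb Z^{X_k}$, $C_{-1}=\mathbb Z$, and integer boundary matrices $\partial_k:C_k\to C_{k-1}$ with $\partial_{k-1}\partial_k=0$ for all $k\ge 1$, where $\partial_0=(1,\dots,1)$ and $\partial_{-1}=0$ (for instance the augmented cellular chain complex of a finite cell complex). Put $Z_k=\ker\partial_k$, $B_k=\operatorname{im}\partial_{k+1}$, $\widetilde H_k(X)=Z_k/B_k$, $\delta_k=\partial_{k+1}^t:C_k\to C_{k+1}$ and $Z^k=\ker\delta_k$. Let $i\ge 0$ and assume $$\operatorname{rk}\widetilde H_{i+1}(X)=0,\qquad \operatorname{rk}\widetilde H_i(X)=1,\qquad \operatorname{rk}\widetilde H_{i-1}(X)=0.$$ For $I\subseteq X_i$ let $X_I=X^{i-1}\cup I$ be the subcomplex consisting of all cells of dimension less than $i$ and the $i$-cells in $I$. Tree numbers. $X_I$ is a spanning tree if the columns of $\partial_i$ indexed by $I$ form a $\mathbb Q$-basis of the column space of $\partial_i$; the spanning tree number is $k_i(X)=\sum_T|\widetilde H_{i-1}(T)|^2$,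 the sum being over all spanning trees $T$. The dual spanning tree number is $k^i(X)=\det\big([\delta_i]_W[\delta_i]_W^t\big)$, where $[\delta_i]_W$ is the matrix of the columns of $\delta_i$ written in a $\mathbb Z$-basis $W$ of $Z^{i+1}$. Standard harmonic cycle. Fix a $\mathbb Z$-basis $Z'$ of $Z_{i-1}$, a $\mathbb Z$-basis $Z$ of $Z_i$ and a $\mathbb Z$-basis $b_1,\dots,b_s$ of $B_i$, and let $r=\operatorname{rk}Z_{i-1}$. The winding number of $z\in Z_i$ is $w(z)=\det\big([z]_Z,[b_1]_Z,\dots,[b_s]_Z\big)$. A cycletree is a subcomplex $U=X_I$ with $|I|=r+1$. Fixing for each $U$ an ordering $\sigma_1,\dots,\sigma_{r+1}$ of its $i$-cells, let $C_U\in Z_i$ be the chain whose coefficient at $\sigma_j$ is $(-1)^j$ times the determinant of the $r\times r$ matrix formed by the columns of $[\partial_i]_{Z'}$ indexed by the $\sigma_l$, $l\ne j$, and whose coefficient at every other $i$-cell is $0$. Let $$\lambda=\sum_U w(C_U)\,C_U,$$ the sum being over all cycletrees $U$, and define the normalized harmonic cycle $\overline\lambda=\lambda/|\widetilde H_{i-1}(X)|\in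 C_i(X;\mathbb Q)$. Then, for every choice of these bases and orderings, $$\overline\lambda\circ\overline\lambda=k_i(X)\,k^i(X),$$ where $\circ$ is the standard inner product on $C_i(X;\mathbb Q)$, for which the $i$-cells are orthonormal. -/

import Mathlib

open Matrix

universe u

/-- A finite complex: finite sets `cells k` of `k`-cells, empty for `k > dim`, together with integer
boundary matrices `bd k`, the matrix of `∂_{k+1} : C_{k+1} → C_k`, such that consecutive boundary
maps compose to zero; `aug_bd` says this for the augmentation `∂_0 = (1, …, 1) : C_0 → C_{-1} = ℤ`.
A cell complex is regarded as the generators of its cellular chain complex. -/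
structure FiniteComplex where
  dim : ℕ
  cells : ℕ → Type u
  [fintypeCells : ∀ k, Fintype (cells k)]
  [decEqCells : ∀ k, DecidableEq (cells k)]
  isEmpty_cells : ∀ k, dim < k → IsEmpty (cells k)
  bd : ∀ k, Matrix (cells k) (cells (k + 1)) ℤ
  bd_mul_bd : ∀ k, bd k * bd (k + 1) = 0
  aug_bd : ∀ e : cells 1, ∑ v, bd 0 v e = 0

attribute [instance] FiniteComplex.fintypeCells FiniteComplex.decEqCells

namespace FiniteComplex

/-- Generators of the augmented chain complex, with degrees shifted by two:
`X.Gen n` generates the chain group `C_{n-2}`, where `C_{-2} = 0` and `C_{-1} = ℤ`.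
In particular `X.Gen (i + 2)` is the set of `i`-cells. -/
def Gen (X : FiniteComplex.{u}) : ℕ → Type u
  | 0 => PEmpty
  | 1 => PUnit
  | k + 2 => X.cells k

instance instFintypeGen (X : FiniteComplex.{u}) : ∀ n, Fintype (X.Gen n)
  | 0 => inferInstanceAs (Fintype PEmpty)
  | 1 => inferInstanceAs (Fintype PUnit)
  | k + 2 => X.fintypeCells k

instance instDecidableEqGen (X : FiniteComplex.{u}) : ∀ n, DecidableEq (X.Gen n)
  | 0 => inferInstanceAs (DecidableEq PEmpty)
  | 1 => inferInstanceAs (DecidableEq PUnit)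
  | k + 2 => X.decEqCells k

/-- The boundary matrices of the augmented complex: `X.D n` is `∂_{n-1} : C_{n-1} → C_{n-2}`,
so that `∂_i = X.D (i + 1)`. -/
def D (X : FiniteComplex.{u}) : ∀ n, Matrix (X.Gen n) (X.Gen (n + 1)) ℤ
  | 0 => 0
  | 1 => fun _ _ => 1
  | k + 2 => X.bd k

theorem D_mul_D (X : FiniteComplex.{u}) : ∀ n, X.D n * X.D (n + 1) = 0
  | 0 => Matrix.zero_mul _
  | 1 => by
      ext a e
      rw [Matrix.mul_apply]
      refine (Finset.sum_congr rfl fun v _ => ?_).trans (X.aug_bd e)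
      exact one_mul _
  | k + 2 => X.bd_mul_bd k

/-- `ker A / im B` for integer matrices `A`, `B` (with `A * B = 0`): the homology at the middle
of `ℤ^m ← ℤ^n ← ℤ^p`. -/
abbrev Homology {m n p : Type*} [Fintype n] [Fintype p]
    (A : Matrix m n ℤ) (B : Matrix n p ℤ) : Type _ :=
  LinearMap.ker A.mulVecLin ⧸
    (LinearMap.range B.mulVecLin).submoduleOf (LinearMap.ker A.mulVecLin)

/-- The cycle group `Z_{n-1}(X) = ker ∂_{n-1}`; so `Z_i(X) = X.cycles (i + 1)`. -/
abbrev cycles (X : FiniteComplex.{u}) (n : ℕ) : Submodule ℤ (X.Gen (n + 1) → ℤ) :=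
  LinearMap.ker (X.D n).mulVecLin

/-- The boundary group `B_{n-1}(X) = im ∂_n`; so `B_i(X) = X.boundaries (i + 1)`. -/
abbrev boundaries (X : FiniteComplex.{u}) (n : ℕ) : Submodule ℤ (X.Gen (n + 1) → ℤ) :=
  LinearMap.range (X.D (n + 1)).mulVecLin

/-- The cocycle group `Z^{n-1}(X) = ker ∂_n^t`; so `Z^i(X) = X.cocycles (i + 1)`. -/
abbrev cocycles (X : FiniteComplex.{u}) (n : ℕ) : Submodule ℤ (X.Gen (n + 1) → ℤ) :=
  LinearMap.ker (X.D (n + 1))ᵀ.mulVecLin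

/-- The reduced homology group `H̃_{n-1}(X)`; so `H̃_i(X) = X.RedHomology (i + 1)`. -/
abbrev RedHomology (X : FiniteComplex.{u}) (n : ℕ) : Type u :=
  Homology (X.D n) (X.D (n + 1))

theorem boundaries_le_cycles (X : FiniteComplex.{u}) (n : ℕ) : X.boundaries n ≤ X.cycles n := by
  rintro _ ⟨y, rfl⟩
  simp [Matrix.mulVec_mulVec, D_mul_D]

/-- The unicycle condition in dimension `i`:
`rk H̃_{i+1}(X) = 0`, `rk H̃_i(X) = 1` and `rk H̃_{i-1}(X) = 0`. -/
def UnicycleCondition (X : FiniteComplex.{u}) (i : ℕ) : Prop :=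
  Module.finrank ℤ (X.RedHomology (i + 2)) = 0 ∧
  Module.finrank ℤ (X.RedHomology (i + 1)) = 1 ∧
  Module.finrank ℤ (X.RedHomology i) = 0

/-! A subcomplex `Y` with `X^{i-1} ⊆ Y ⊆ X^i` is given by its set `I` of `i`-cells,
`I : Finset (X.Gen (i + 2))`. Its chain groups are those of `X` in degrees below `i`, and `ℤ^I` in
degree `i`. -/

/-- The `i`-th boundary matrix `∂_i|_I` of the subcomplex `X^{i-1} ∪ I`: the columns of `∂_i`
indexed by `I`. -/
def bdRestrict (X : FiniteComplex.{u}) (i : ℕ) (I : Finset (X.Gen (i + 2))) :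
    Matrix (X.Gen (i + 1)) I ℤ :=
  (X.D (i + 1)).submatrix id Subtype.val

/-- The order `|H̃_{i-1}(Y)|` for `Y = X^{i-1} ∪ I`, and `0` if that group is infinite. -/
noncomputable def weight (X : FiniteComplex.{u}) (i : ℕ) (I : Finset (X.Gen (i + 2))) : ℕ :=
  Nat.card (Homology (X.D i) (X.bdRestrict i I))

/-- The column of `∂_i` indexed by the `i`-cell `σ`, as a rational vector. -/
def ratCol (X : FiniteComplex.{u}) (i : ℕ) (σ : X.Gen (i + 2)) : X.Gen (i + 1) → ℚ :=
  fun τ => (X.D (i + 1) τ σ : ℚ)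

/-- `X^{i-1} ∪ I` is an `i`-dimensional spanning tree: the columns of `∂_i` indexed by `I` form a
`ℚ`-basis of the column space of `∂_i`. -/
def IsSpanningTree (X : FiniteComplex.{u}) (i : ℕ) (I : Finset (X.Gen (i + 2))) : Prop :=
  LinearIndependent ℚ (fun σ : I => X.ratCol i σ) ∧
  Submodule.span ℚ (X.ratCol i '' (I : Set (X.Gen (i + 2)))) =
    Submodule.span ℚ (Set.range (X.ratCol i))

open Classical in
/-- The `i`-tree number `k_i(X)`: the sum of `|H̃_{i-1}(T)|²` over all `i`-dimensional spanning
trees `T`. -/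
noncomputable def treeNumber (X : FiniteComplex.{u}) (i : ℕ) : ℕ :=
  ∑ I : Finset (X.Gen (i + 2)) with X.IsSpanningTree i I, X.weight i I ^ 2

/-- `∂_i σ` as an element of `Z_{i-1}(X)`. -/
def bdCycle (X : FiniteComplex.{u}) (i : ℕ) (σ : X.Gen (i + 2)) : X.cycles i :=
  ⟨(X.D (i + 1)).mulVec (Pi.single σ 1), X.boundaries_le_cycles i ⟨Pi.single σ 1, rfl⟩⟩

/-- `δ_i σ = ∂_{i+1}^t σ` as an element of `Z^{i+1}(X)`. -/
def cobdCocycle (X : FiniteComplex.{u}) (i : ℕ) (σ : X.Gen (i + 2)) : X.cocycles (i + 2) :=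
  ⟨(X.D (i + 2))ᵀ.mulVec (Pi.single σ 1), by
    rw [LinearMap.mem_ker, Matrix.mulVecLin_apply, Matrix.mulVec_mulVec, ← Matrix.transpose_mul,
      D_mul_D, Matrix.transpose_zero, Matrix.zero_mulVec]⟩

/-- `[∂_i]_Z`: the columns of `∂_i` written in a basis `Z` of `Z_{i-1}(X)`. -/
noncomputable def bdCoord (X : FiniteComplex.{u}) (i : ℕ) {r : ℕ} (Z : Module.Basis (Fin r) ℤ (X.cycles i)) :
    Matrix (Fin r) (X.Gen (i + 2)) ℤ :=
  fun a σ => Z.repr (X.bdCycle i σ) a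

/-- `[δ_i]_Z`: the columns of `δ_i` written in a basis `Z` of `Z^{i+1}(X)`. -/
noncomputable def cobdCoord (X : FiniteComplex.{u}) (i : ℕ) {t : ℕ}
    (Z : Module.Basis (Fin t) ℤ (X.cocycles (i + 2))) : Matrix (Fin t) (X.Gen (i + 2)) ℤ :=
  fun a σ => Z.repr (X.cobdCocycle i σ) a

/-- The dual tree number `k^i(X) = det([δ_i]_Z [δ_i]_Z^t)`, computed in a basis `Z` of
`Z^{i+1}(X)`. -/
noncomputable def dualTreeNumber (X : FiniteComplex.{u}) (i : ℕ) {t : ℕ}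
    (Z : Module.Basis (Fin t) ℤ (X.cocycles (i + 2))) : ℤ :=
  (X.cobdCoord i Z * (X.cobdCoord i Z)ᵀ).det

/-- The `i`-dimensional cycletrees `U`, given by their sets `I(U)` of `i`-cells:
`|I(U)| = rk Z_{i-1}(X) + 1`. -/
abbrev Cycletree (X : FiniteComplex.{u}) (i : ℕ) : Type u :=
  {U : Finset (X.Gen (i + 2)) // U.card = Module.finrank ℤ (X.cycles i) + 1}

/-- For an `r × (r+1)` matrix `A`, the vector whose `j`-th component, `j = 1, …, r + 1`, is
`(-1)^j` times the determinant of `A` without its `j`-th column. (`Fin` counts from `0`.) -/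
def signedMinors {r : ℕ} (A : Matrix (Fin r) (Fin (r + 1)) ℤ) : Fin (r + 1) → ℤ :=
  fun j => (-1) ^ (j.val + 1) * (A.submatrix id j.succAbove).det

theorem mulVec_signedMinors {r : ℕ} (A : Matrix (Fin r) (Fin (r + 1)) ℤ) :
    A.mulVec (signedMinors A) = 0 := by
  ext k
  let M : Matrix (Fin (r + 1)) (Fin (r + 1)) ℤ := Fin.cons (A k) A
  have h0 : M.det = 0 :=
    Matrix.det_zero_of_row_eq (i := 0) (j := k.succ) (Fin.succ_ne_zero k).symm rfl
  rw [Matrix.det_succ_row_zero] at h0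
  have h1 : ∀ j, A k j * signedMinors A j =
      -((-1) ^ (j : ℕ) * M 0 j * (M.submatrix Fin.succ j.succAbove).det) := by
    intro j
    have h2 : M 0 j = A k j := rfl
    have h3 : M.submatrix Fin.succ j.succAbove = A.submatrix id j.succAbove := rfl
    rw [h2, h3, signedMinors, pow_succ]
    ring
  simp only [Matrix.mulVec, dotProduct, h1, Finset.sum_neg_distrib, h0, neg_zero, Pi.zero_apply]

/-- The vector `C_U` of a set `U` of `r + 1` `i`-cells listed in the order `e`: the vector of signed
maximal minors of `[∂_i]_Z|_U`, extended by zero. -/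
noncomputable def cyclePart (X : FiniteComplex.{u}) (i : ℕ) {r : ℕ} (Z : Module.Basis (Fin r) ℤ (X.cycles i))
    (U : Finset (X.Gen (i + 2))) (e : Fin (r + 1) ≃ U) : X.Gen (i + 2) → ℤ :=
  fun σ => if h : σ ∈ U then
    signedMinors ((X.bdCoord i Z).submatrix id fun j => (e j : X.Gen (i + 2))) (e.symm ⟨σ, h⟩)
  else 0

theorem cyclePart_mem (X : FiniteComplex.{u}) (i : ℕ) {r : ℕ}
    (Z : Module.Basis (Fin r) ℤ (X.cycles i)) (U : Finset (X.Gen (i + 2)))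
    (e : Fin (r + 1) ≃ U) : X.cyclePart i Z U e ∈ X.cycles (i + 1) := by
  set v := X.cyclePart i Z U e with hv
  have key : ∑ σ, v σ • X.bdCycle i σ = 0 := by
    apply Z.repr.injective
    ext a
    have h1 := congrFun (mulVec_signedMinors
      ((X.bdCoord i Z).submatrix id fun j => (e j : X.Gen (i + 2)))) a
    have h2 : ∑ σ, v σ * Z.repr (X.bdCycle i σ) a = 0 := by
      rw [Pi.zero_apply] at h1
      rw [← h1, Matrix.mulVec, dotProduct, ← Finset.sum_subset (Finset.subset_univ U),
        ← Finset.sum_coe_sort, ← e.sum_comp]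
      · refine Finset.sum_congr rfl fun j _ => ?_
        simp [hv, cyclePart, bdCoord, mul_comm]
      · intro σ _ h
        simp [hv, cyclePart, h]
    simpa [Finsupp.finsetSum_apply] using h2
  have h3 := congrArg Subtype.val key
  rw [LinearMap.mem_ker, Matrix.mulVecLin_apply]
  rw [Submodule.coe_zero] at h3
  rw [← h3]
  ext τ
  simp [bdCycle, Matrix.mulVec, dotProduct, mul_comm]

/-- The cycle part `C_U` as an element of `Z_i(X)`. -/
noncomputable def cyclePartCycle (X : FiniteComplex.{u}) (i : ℕ) {r : ℕ}
    (Z : Module.Basis (Fin r) ℤ (X.cycles i)) (U : Finset (X.Gen (i + 2)))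
    (e : Fin (r + 1) ≃ U) : X.cycles (i + 1) :=
  ⟨X.cyclePart i Z U e, X.cyclePart_mem i Z U e⟩

/-- The `i`-winding number `w(z) = det([z]_Z, [∂̄_{i+1}]_Z)`, where `Z` is a basis of `Z_i(X)` and
the columns `B` of `∂̄_{i+1}` form a basis of the lattice `B_i(X) = im ∂_{i+1}`. -/
noncomputable def windingNumber (X : FiniteComplex.{u}) (i : ℕ) {s : ℕ}
    (Z : Module.Basis (Fin (s + 1)) ℤ (X.cycles (i + 1)))
    (B : Module.Basis (Fin s) ℤ (X.boundaries (i + 1))) (z : X.cycles (i + 1)) : ℤ :=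
  Z.det (Fin.cons z fun j => Submodule.inclusion (X.boundaries_le_cycles (i + 1)) (B j))

/-- The standard harmonic cycle `λ = ∑_U w(C_U) C_U`, the sum being over all `i`-cycletrees. -/
noncomputable def standardHarmonicCycle (X : FiniteComplex.{u}) (i : ℕ) {r s : ℕ}
    (Z' : Module.Basis (Fin r) ℤ (X.cycles i)) (e : ∀ U : X.Cycletree i, Fin (r + 1) ≃ U.1)
    (Z : Module.Basis (Fin (s + 1)) ℤ (X.cycles (i + 1)))
    (B : Module.Basis (Fin s) ℤ (X.boundaries (i + 1))) : X.cycles (i + 1) :=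
  ∑ U : X.Cycletree i,
    X.windingNumber i Z B (X.cyclePartCycle i Z' U.1 (e U)) • X.cyclePartCycle i Z' U.1 (e U)

/-- The normalized harmonic cycle `λ / |H̃_{i-1}(X)|`, a rational `i`-chain. -/
noncomputable def normalizedHarmonicCycle (X : FiniteComplex.{u}) (i : ℕ) {r s : ℕ}
    (Z' : Module.Basis (Fin r) ℤ (X.cycles i)) (e : ∀ U : X.Cycletree i, Fin (r + 1) ≃ U.1)
    (Z : Module.Basis (Fin (s + 1)) ℤ (X.cycles (i + 1)))
    (B : Module.Basis (Fin s) ℤ (X.boundaries (i + 1))) : X.Gen (i + 2) → ℚ :=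
  fun σ => ((X.standardHarmonicCycle i Z' e Z B : X.Gen (i + 2) → ℤ) σ : ℚ) /
    (Nat.card (X.RedHomology i) : ℚ)

end FiniteComplex

/-! ### Cauchy–Binet, determinants and ranks over `ℤ`. -/

namespace Matrix

/-! Write `M = [∂_i]_{Z'}`, `d = det(M Mᵗ)`, `h = |H̃_{i-1}(X)|`, and `G(·)` for Gram determinants.
Pairing a chain `x` with `C_U` gives, up to sign, the maximal minor at `U` of `M` with `x` added as
a first row. Extend the functional `w` from `Z_i` to all chains. Cauchy–Binet then yields `λ ∘ z = d
w(z)` for every cycle `z` (`standardHarmonicCycle_dotProduct`), so `λ` is orthogonal to `B_i`.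

Evaluate the Gram determinant of `λ, b_1, …, b_s` twice: orthogonality gives `(λ ∘ λ) G(B)`, and
change of basis in `Z_i` gives `w(λ)² G(Z)`. Since `λ ∘ λ = d w(λ)`, `w(λ) ≠ 0` and `d = h² G(Z)`
with `h ≠ 0`, it follows that `w(λ) = h² G(B)` and `λ ∘ λ = h² d G(B)`. Dividing by `h²` leaves `d
G(B)`.

Three identifications remain. The relation `d = h² G(Z)` compares covolumes after completing `Z` to
a basis of `C_i` by lifts of a basis of `B_{i-1}` (`det_bdCoord_mul_transpose`). Next, `d = k_i(X)`
because the nonzero maximal minors of `M` are, up to sign, the orders `|H̃_{i-1}(T)|`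
(`treeNumber_eq_det`). Finally `G(B) = k^i(X)` because the rows of `[δ_i]_W` form a `ℤ`-basis of
`B_i` (`dualTreeNumber_eq_gramDet`). -/

/-- Multilinear expansion in the rows gives a sum over maps `Fin k → n`. Non-injective maps
contribute zero, and the injective ones with image `U` correspond to permutations through `e U`. The
orderings are arbitrary since both minors change by the same sign. -/
theorem cauchyBinet {R n : Type*} [CommRing R] [Fintype n] [DecidableEq n] {k : ℕ}
    (e : ∀ U : {U : Finset n // U.card = k}, Fin k ≃ U.1) (A B : Matrix (Fin k) n R) :
    (A * Bᵀ).det = ∑ U : {U : Finset n // U.card = k},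
      (A.submatrix id fun j => (e U j : n)).det * (B.submatrix id fun j => (e U j : n)).det := by
  have hexp : (A * Bᵀ).det = ∑ f : Fin k → n, (∏ j, A j (f j)) * (Bᵀ.submatrix f id).det := by
    have h1 : A * Bᵀ = fun j => ∑ x, A j x • Bᵀ x := by
      ext a b
      simp [Matrix.mul_apply, Finset.sum_apply]
    have h2 := (detRowAlternating (R := R) (n := Fin k)).toMultilinearMap.map_sum
      fun j x => A j x • Bᵀ x
    rw [h1]
    refine h2.trans (Finset.sum_congr rfl fun f _ => ?_)
    exact MultilinearMap.map_smul_univ _ (fun j => A j (f j)) fun j => Bᵀ (f j)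
  have hblock : ∀ U, (A.submatrix id fun j => (e U j : n)).det *
      (B.submatrix id fun j => (e U j : n)).det =
      ∑ p : Equiv.Perm (Fin k), (∏ j, A j (e U (p j))) *
        (Bᵀ.submatrix (fun j => (e U (p j) : n)) id).det := by
    intro U
    rw [← det_transpose (A.submatrix _ _), det_apply', Finset.sum_mul]
    refine Finset.sum_congr rfl fun p _ => ?_
    have h3 : Bᵀ.submatrix (fun j => (e U (p j) : n)) id =
        ((B.submatrix id fun j => (e U j : n))ᵀ).submatrix p id := rfl
    rw [h3, det_permute, det_transpose]
    simp only [transpose_apply, submatrix_apply, id]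
    ring
  rw [hexp, Finset.sum_congr rfl fun U _ => hblock U, ← Fintype.sum_sigma']
  symm
  refine Fintype.sum_of_injective
    (fun q : (_ : {U : Finset n // U.card = k}) × Equiv.Perm (Fin k) =>
      fun j => (e q.1 (q.2 j) : n)) ?_ _ _ ?_ fun _ => rfl
  · rintro ⟨U, p⟩ ⟨V, q⟩ h
    have hr : ∀ (U : {U : Finset n // U.card = k}) (p : Equiv.Perm (Fin k)),
        Set.range (fun j => (e U (p j) : n)) = (U.1 : Set n) := by
      intro U p
      ext x
      constructor
      · rintro ⟨j, rfl⟩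
        exact (e U (p j)).2
      · intro hx
        exact ⟨p.symm ((e U).symm ⟨x, hx⟩), by simp⟩
    have hUV : U = V := by
      apply Subtype.ext
      rw [← Finset.coe_inj, ← hr U p, ← hr V q]
      exact congrArg Set.range h
    subst hUV
    congr 1
    ext j
    have := congrFun h j
    simpa [Subtype.coe_inj] using congrArg Fin.val ((e U).injective (Subtype.ext this))
  · intro f hf
    by_cases hinj : Function.Injective f
    · refine absurd ?_ hf
      let U : {U : Finset n // U.card = k} := ⟨Finset.univ.image f, by
        rw [Finset.card_image_of_injective _ hinj, Finset.card_fin]⟩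
      let g : Fin k → Fin k := fun j =>
        (e U).symm ⟨f j, Finset.mem_image_of_mem f (Finset.mem_univ j)⟩
      have hg : Function.Injective g := fun a b h => hinj (by simpa [g] using h)
      refine ⟨⟨U, Equiv.ofBijective g (Finite.injective_iff_bijective.1 hg)⟩, ?_⟩
      ext j
      simp [g]
    · simp only [Function.Injective, not_forall] at hinj
      obtain ⟨a, b, hab, hne⟩ := hinj
      rw [det_zero_of_row_eq hne (by ext; simp [hab]), mul_zero]

/-- The range of `A` is free over `ℤ`, so `A = C * Q` factors through `ℤ^rank`. -/
theorem rank_transpose_le_int {m n : Type*} [Fintype m] [Fintype n]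
    (A : Matrix m n ℤ) : Aᵀ.rank ≤ A.rank := by
  classical
  let b := Module.finBasis ℤ (LinearMap.range A.mulVecLin)
  let C : Matrix m (Fin A.rank) ℤ := fun i j => (b j : m → ℤ) i
  let y : n → LinearMap.range A.mulVecLin := fun x => ⟨A *ᵥ Pi.single x 1, ⟨_, rfl⟩⟩
  let Q : Matrix (Fin A.rank) n ℤ := fun j x => b.repr (y x) j
  have hA : A = C * Q := by
    ext i x
    have h : ((∑ j, b.repr (y x) j • b j : LinearMap.range A.mulVecLin) : m → ℤ) i = A i x := by
      rw [b.sum_repr]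
      simp [y]
    rw [← h, mul_apply, Submodule.coe_sum, Finset.sum_apply]
    exact Finset.sum_congr rfl fun j _ => mul_comm _ _
  calc Aᵀ.rank = (Qᵀ * Cᵀ).rank := by rw [← transpose_mul, ← hA]
    _ ≤ Qᵀ.rank := rank_mul_le_left _ _
    _ ≤ Fintype.card (Fin A.rank) := rank_le_card_width _
    _ = A.rank := Fintype.card_fin _

theorem rank_transpose_int {m n : Type*} [Fintype m] [Fintype n]
    (A : Matrix m n ℤ) : Aᵀ.rank = A.rank :=
  le_antisymm A.rank_transpose_le_int Aᵀ.rank_transpose_le_int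

theorem det_ne_zero_of_linearIndependent_cols {n R : Type*} [Fintype n] [DecidableEq n]
    [CommRing R] [IsDomain R] {A : Matrix n n R} (h : LinearIndependent R A.col) :
    A.det ≠ 0 := by
  intro h0
  obtain ⟨v, hv, hAv⟩ := exists_mulVec_eq_zero_iff.2 h0
  exact hv (mulVec_injective_iff.2 h (by rw [hAv, mulVec_zero]))

theorem det_transpose_mul_self_ne_zero {m n : Type*} [Fintype m] [Fintype n] [DecidableEq n]
    {A : Matrix m n ℤ} (h : Function.Injective A.mulVec) : (Aᵀ * A).det ≠ 0 := by
  intro h0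
  obtain ⟨v, hv, hAv⟩ := exists_mulVec_eq_zero_iff.2 h0
  have h1 : A *ᵥ v ⬝ᵥ A *ᵥ v = 0 := by
    rw [dotProduct_mulVec, ← mulVec_transpose, mulVec_mulVec, hAv, zero_dotProduct]
  exact hv (h (by rw [dotProduct_self_eq_zero.1 h1, mulVec_zero]))

/-- The matrix `M` with a new first row `x`. -/
def consRow {R n : Type*} {r : ℕ} (x : n → R) (M : Matrix (Fin r) n R) :
    Matrix (Fin (r + 1)) n R :=
  Matrix.of (Fin.cons x M.row)

@[simp]
theorem consRow_zero {R n : Type*} {r : ℕ} (x : n → R) (M : Matrix (Fin r) n R) (c : n) :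
    consRow x M 0 c = x c := rfl

@[simp]
theorem consRow_succ {R n : Type*} {r : ℕ} (x : n → R) (M : Matrix (Fin r) n R) (a : Fin r)
    (c : n) : consRow x M a.succ c = M a c := rfl

/-- Laplace expansion along the first row; the minus sign comes from `(-1)^(j+1)` with `j` counted
from `0`. -/
theorem dotProduct_signedMinors {r : ℕ} (A : Matrix (Fin r) (Fin (r + 1)) ℤ)
    (x : Fin (r + 1) → ℤ) :
    FiniteComplex.signedMinors A ⬝ᵥ x = -(consRow x A).det := by
  rw [det_succ_row_zero, dotProduct, ← Finset.sum_neg_distrib]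
  refine Finset.sum_congr rfl fun j _ => ?_
  have h : (consRow x A).submatrix Fin.succ j.succAbove = A.submatrix id j.succAbove := rfl
  rw [h, FiniteComplex.signedMinors, pow_succ, consRow_zero]
  ring

/-- As `M y = 0`, the first column of the product is `(x ⬝ᵥ y, 0, …, 0)`. Nothing is asked of `x`.
-/
theorem det_consRow_mul_transpose_consRow {r : ℕ} {n : Type*} [Fintype n]
    (M : Matrix (Fin r) n ℤ) (x y : n → ℤ) (hy : M *ᵥ y = 0) :
    (consRow x M * (consRow y M)ᵀ).det = (x ⬝ᵥ y) * (M * Mᵀ).det := by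
  rw [det_succ_column_zero, Fin.sum_univ_succ, Finset.sum_eq_zero]
  · have h : (consRow x M * (consRow y M)ᵀ).submatrix (Fin.succAbove 0) Fin.succ = M * Mᵀ := by
      ext a b
      simp [mul_apply]
    rw [add_zero, h]
    simp [mul_apply, dotProduct]
  · intro a _
    have h : (consRow x M * (consRow y M)ᵀ) a.succ 0 = (M *ᵥ y) a := by
      simp [mul_apply, mulVec, dotProduct]
    rw [h, hy]
    simp

/-- A linear functional on the kernel of an integer matrix extends to the whole lattice. -/
theorem exists_extend_ker {m n : Type*} [Fintype n] [Finite m] [DecidableEq n] (A : Matrix m n ℤ)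
    (φ : LinearMap.ker A.mulVecLin →ₗ[ℤ] ℤ) :
    ∃ w : n → ℤ, ∀ z : LinearMap.ker A.mulVecLin, φ z = w ⬝ᵥ (z : n → ℤ) := by
  -- The range is projective, so the kernel is a direct summand; `f` below is the projection onto
  -- it.
  obtain ⟨g, hg⟩ := A.mulVecLin.rangeRestrict.exists_rightInverse_of_surjective
    (LinearMap.range_rangeRestrict _)
  let f : (n → ℤ) →ₗ[ℤ] (n → ℤ) := LinearMap.id - g ∘ₗ A.mulVecLin.rangeRestrict
  have hf : ∀ x, f x ∈ LinearMap.ker A.mulVecLin := by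
    intro x
    have h : A.mulVecLin (g (A.mulVecLin.rangeRestrict x)) = A.mulVecLin x :=
      congrArg Subtype.val (LinearMap.congr_fun hg (A.mulVecLin.rangeRestrict x))
    rw [LinearMap.mem_ker, LinearMap.sub_apply, map_sub, LinearMap.comp_apply, h]
    exact sub_self _
  let ψ : (n → ℤ) →ₗ[ℤ] ℤ := φ ∘ₗ f.codRestrict _ hf
  refine ⟨fun x => ψ (Pi.single x 1), fun z => ?_⟩
  have h1 : φ z = ψ z := by
    have h2 : A.mulVecLin.rangeRestrict (z : n → ℤ) = 0 := Subtype.ext z.2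
    refine congrArg φ (Subtype.ext ?_)
    simp [f, h2]
  have h3 : (z : n → ℤ) = ∑ x, (z : n → ℤ) x • Pi.single x (1 : ℤ) := by
    ext x
    simp [Finset.sum_apply, Pi.single_apply]
  rw [h1, h3, map_sum, ← h3]
  exact Finset.sum_congr rfl fun x _ => by rw [map_smul, smul_eq_mul, mul_comm]

end Matrix

/-! ### Gram determinants of families in a sublattice. -/

/-- The Gram determinant of a family of vectors of a sublattice of `ℤ^n`. -/
def gramDet {n ι : Type*} [Fintype n] [Fintype ι] [DecidableEq ι] {S : Submodule ℤ (n → ℤ)}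
    (v : ι → S) : ℤ :=
  ((Matrix.of fun a => (v a : n → ℤ)) * (Matrix.of fun a => (v a : n → ℤ))ᵀ).det

theorem gramDet_eq_det_sq_mul {n ι : Type*} [Fintype n] [Fintype ι] [DecidableEq ι]
    {S : Submodule ℤ (n → ℤ)} (Z : Module.Basis ι ℤ S) (v : ι → S) :
    gramDet v = Z.det v ^ 2 * gramDet Z := by
  have h : (Matrix.of fun a => (v a : n → ℤ)) =
      (Z.toMatrix v)ᵀ * Matrix.of fun a => (Z a : n → ℤ) := by
    ext a x
    rw [mul_apply, of_apply, ← Z.sum_repr (v a), Submodule.coe_sum, Finset.sum_apply]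
    simp [Module.Basis.toMatrix_apply]
  rw [gramDet, h, transpose_mul, transpose_transpose, gramDet, Module.Basis.det_apply,
    Matrix.mul_assoc, ← Matrix.mul_assoc _ _ (Z.toMatrix v), det_mul, det_mul, det_transpose]
  ring

theorem gramDet_ne_zero {n ι : Type*} [Fintype n] [Fintype ι] [DecidableEq ι]
    {S : Submodule ℤ (n → ℤ)} {v : ι → S} (hv : LinearIndependent ℤ v) : gramDet v ≠ 0 := by
  have h := det_transpose_mul_self_ne_zero (A := (Matrix.of fun a => (v a : n → ℤ))ᵀ) <| by
    rw [mulVec_injective_iff]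
    exact hv.map' S.subtype S.ker_subtype
  rwa [transpose_transpose] at h

theorem gramDet_cons {n : Type*} [Fintype n] {s : ℕ} {S : Submodule ℤ (n → ℤ)} (x : S)
    (v : Fin s → S) (hx : ∀ j, (x : n → ℤ) ⬝ᵥ v j = 0) :
    gramDet (Fin.cons x v : Fin (s + 1) → S) = ((x : n → ℤ) ⬝ᵥ x) * gramDet v := by
  have h : (Matrix.of fun a => ((Fin.cons x v : Fin (s + 1) → S) a : n → ℤ)) =
      consRow (x : n → ℤ) (Matrix.of fun a => (v a : n → ℤ)) := by
    ext a c
    induction a using Fin.cases <;> simp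
  rw [gramDet, h, det_consRow_mul_transpose_consRow, gramDet]
  ext j
  rw [mulVec, dotProduct_comm]
  exact hx j

theorem Module.Basis.exists_det_cons_ne_zero {R V : Type*} [CommRing R] [IsDomain R]
    [AddCommGroup V] [Module R V] {s : ℕ} (Z : Module.Basis (Fin (s + 1)) R V)
    {v : Fin s → V} (hv : LinearIndependent R v) : ∃ x, Z.det (Fin.cons x v) ≠ 0 := by
  obtain ⟨x, hx⟩ := exists_linearIndependent_cons_of_lt_finrank hv
    (by rw [Module.finrank_eq_card_basis Z, Fintype.card_fin]; exact Nat.lt_succ_self s)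
  refine ⟨x, ?_⟩
  rw [Module.Basis.det_apply]
  exact det_ne_zero_of_linearIndependent_cols
    (hx.map' Z.equivFun.toLinearMap Z.equivFun.ker)

/-! ### Pairing the harmonic cycle with cycles. -/

namespace FiniteComplex

variable (X : FiniteComplex.{u}) (i : ℕ)

theorem bdCycle_sum (x : X.Gen (i + 2) → ℤ) :
    ∑ σ, x σ • X.bdCycle i σ =
      ⟨X.D (i + 1) *ᵥ x, X.boundaries_le_cycles i ⟨x, rfl⟩⟩ := by
  apply Subtype.ext
  ext τ
  simp [bdCycle, mulVec, dotProduct, mul_comm]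

theorem bdCoord_mulVec {r : ℕ} (Z' : Module.Basis (Fin r) ℤ (X.cycles i))
    (x : X.Gen (i + 2) → ℤ) :
    X.bdCoord i Z' *ᵥ x =
      Z'.equivFun ⟨X.D (i + 1) *ᵥ x, X.boundaries_le_cycles i ⟨x, rfl⟩⟩ := by
  ext a
  rw [← bdCycle_sum, map_sum, Finset.sum_apply]
  simp [mulVec, dotProduct, bdCoord, mul_comm]

theorem bdCoord_mulVec_cycle {r : ℕ} (Z' : Module.Basis (Fin r) ℤ (X.cycles i))
    (z : X.cycles (i + 1)) : X.bdCoord i Z' *ᵥ (z : X.Gen (i + 2) → ℤ) = 0 := by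
  rw [bdCoord_mulVec, ← map_zero Z'.equivFun]
  exact congrArg _ (Subtype.ext z.2)

theorem dotProduct_cyclePart {r : ℕ} (Z' : Module.Basis (Fin r) ℤ (X.cycles i))
    (U : Finset (X.Gen (i + 2))) (e : Fin (r + 1) ≃ U) (x : X.Gen (i + 2) → ℤ) :
    x ⬝ᵥ X.cyclePart i Z' U e =
      -((consRow x (X.bdCoord i Z')).submatrix id fun j => (e j : X.Gen (i + 2))).det := by
  have h1 : (consRow x (X.bdCoord i Z')).submatrix id (fun j => (e j : X.Gen (i + 2))) =
      consRow (fun j => x (e j)) ((X.bdCoord i Z').submatrix id fun j => (e j : X.Gen (i + 2))) := by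
    ext a j
    induction a using Fin.cases <;> simp
  rw [h1, ← dotProduct_signedMinors, dotProduct, dotProduct,
    ← Finset.sum_subset (Finset.subset_univ U), ← Finset.sum_coe_sort, ← e.sum_comp]
  · exact Finset.sum_congr rfl fun j _ => by simp [cyclePart, mul_comm]
  · intro σ _ h
    simp [cyclePart, h]

/-- Each factor is minus a maximal minor of `[∂_i]_{Z'}` with a row added, so the sum is a
Cauchy–Binet expansion. Only `z` has to be a cycle, which leaves `x` free to represent the winding
number. -/
theorem sum_dotProduct_cyclePart {r : ℕ} (Z' : Module.Basis (Fin r) ℤ (X.cycles i))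
    (e : ∀ U : X.Cycletree i, Fin (r + 1) ≃ U.1) (x : X.Gen (i + 2) → ℤ)
    (z : X.cycles (i + 1)) :
    ∑ U : X.Cycletree i, (x ⬝ᵥ X.cyclePart i Z' U.1 (e U)) *
        ((z : X.Gen (i + 2) → ℤ) ⬝ᵥ X.cyclePart i Z' U.1 (e U)) =
      (x ⬝ᵥ z) * (X.bdCoord i Z' * (X.bdCoord i Z')ᵀ).det := by
  -- Cycletrees have `finrank + 1` cells; identifying `r` with this rank lets `e` serve as the
  -- enumeration in `cauchyBinet`.
  obtain rfl : r = Module.finrank ℤ (X.cycles i) := by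
    rw [Module.finrank_eq_card_basis Z', Fintype.card_fin]
  rw [← det_consRow_mul_transpose_consRow _ _ _ (X.bdCoord_mulVec_cycle i Z' z), cauchyBinet e]
  refine Finset.sum_congr rfl fun U _ => ?_
  rw [dotProduct_cyclePart, dotProduct_cyclePart, neg_mul_neg]

theorem exists_windingNumber_eq_dotProduct {s : ℕ}
    (Z : Module.Basis (Fin (s + 1)) ℤ (X.cycles (i + 1)))
    (B : Module.Basis (Fin s) ℤ (X.boundaries (i + 1))) :
    ∃ w : X.Gen (i + 2) → ℤ, ∀ z : X.cycles (i + 1),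
      X.windingNumber i Z B z = w ⬝ᵥ (z : X.Gen (i + 2) → ℤ) := by
  let φ : X.cycles (i + 1) →ₗ[ℤ] ℤ :=
    { toFun := X.windingNumber i Z B
      map_add' := fun x y => by
        have h := Z.det.curryLeft.map_add x y
        exact DFunLike.congr_fun h _
      map_smul' := fun c x => by
        have h := Z.det.curryLeft.map_smul c x
        exact DFunLike.congr_fun h _ }
  exact exists_extend_ker _ φ

/-- Thus `λ` represents the functional `d w` on `Z_i`, whatever orderings `e` are chosen. -/
theorem standardHarmonicCycle_dotProduct {r s : ℕ}
    (Z' : Module.Basis (Fin r) ℤ (X.cycles i)) (e : ∀ U : X.Cycletree i, Fin (r + 1) ≃ U.1)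
    (Z : Module.Basis (Fin (s + 1)) ℤ (X.cycles (i + 1)))
    (B : Module.Basis (Fin s) ℤ (X.boundaries (i + 1))) (z : X.cycles (i + 1)) :
    (X.standardHarmonicCycle i Z' e Z B : X.Gen (i + 2) → ℤ) ⬝ᵥ z =
      X.windingNumber i Z B z * (X.bdCoord i Z' * (X.bdCoord i Z')ᵀ).det := by
  obtain ⟨w, hw⟩ := X.exists_windingNumber_eq_dotProduct i Z B
  rw [hw, ← sum_dotProduct_cyclePart X i Z' e, standardHarmonicCycle, Submodule.coe_sum,
    sum_dotProduct]
  refine Finset.sum_congr rfl fun U _ => ?_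
  rw [hw, Submodule.coe_smul, smul_dotProduct, smul_eq_mul]
  exact congrArg _ (dotProduct_comm _ _)

theorem windingNumber_boundary {s : ℕ}
    (Z : Module.Basis (Fin (s + 1)) ℤ (X.cycles (i + 1)))
    (B : Module.Basis (Fin s) ℤ (X.boundaries (i + 1))) (j : Fin s) :
    X.windingNumber i Z B (Submodule.inclusion (X.boundaries_le_cycles (i + 1)) (B j)) = 0 :=
  Z.det.map_eq_zero_of_eq _ (i := 0) (j := j.succ) rfl (Fin.succ_ne_zero j).symm

/-- The square of the length of the standard harmonic cycle, up to the comparison of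
`det (∂ ∂ᵗ)` with the Gram determinant of the cycle lattice. -/
theorem standardHarmonicCycle_dotProduct_self {r s : ℕ}
    (Z' : Module.Basis (Fin r) ℤ (X.cycles i)) (e : ∀ U : X.Cycletree i, Fin (r + 1) ≃ U.1)
    (Z : Module.Basis (Fin (s + 1)) ℤ (X.cycles (i + 1)))
    (B : Module.Basis (Fin s) ℤ (X.boundaries (i + 1))) (h : ℤ)
    (hd : (X.bdCoord i Z' * (X.bdCoord i Z')ᵀ).det = h ^ 2 * gramDet Z) (hh : h ≠ 0) :
    (X.standardHarmonicCycle i Z' e Z B : X.Gen (i + 2) → ℤ) ⬝ᵥ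
        (X.standardHarmonicCycle i Z' e Z B : X.Gen (i + 2) → ℤ) =
      h ^ 2 * (X.bdCoord i Z' * (X.bdCoord i Z')ᵀ).det * gramDet B := by
  set l := X.standardHarmonicCycle i Z' e Z B with hl
  set b := fun j => Submodule.inclusion (X.boundaries_le_cycles (i + 1)) (B j) with hb
  have hdot := X.standardHarmonicCycle_dotProduct i Z' e Z B
  rw [← hl] at hdot
  have hZ : gramDet Z ≠ 0 := gramDet_ne_zero Z.linearIndependent
  -- The two evaluations of the Gram determinant of `λ, b_1, …, b_s`.
  have hgram : ((l : X.Gen (i + 2) → ℤ) ⬝ᵥ l) * gramDet B =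
      X.windingNumber i Z B l ^ 2 * gramDet Z := by
    rw [windingNumber, ← gramDet_eq_det_sq_mul, gramDet_cons]
    · rfl
    · intro j
      rw [hdot, windingNumber_boundary, zero_mul]
  -- If `w(λ) = 0` then `λ ∘ λ = 0`, so `λ = 0` and `d w` vanishes on `Z_i`; but `d ≠ 0`, and `w ≠
  -- 0` because the `b_j` are independent.
  have hw : X.windingNumber i Z B l ≠ 0 := by
    intro h0
    have hself := hdot l
    rw [h0, zero_mul, dotProduct_self_eq_zero] at hself
    obtain ⟨x, hx⟩ := Z.exists_det_cons_ne_zero (v := b)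
      (B.linearIndependent.map' _ (Submodule.ker_inclusion _ _ _))
    have := hdot x
    rw [hself, zero_dotProduct, hd] at this
    exact mul_ne_zero hx (mul_ne_zero (pow_ne_zero 2 hh) hZ) this.symm
  rw [hdot l, hd] at hgram ⊢
  apply mul_left_cancel₀ hw
  linear_combination (-h ^ 2) * hgram

end FiniteComplex

/-! ### Comparing `det(M Mᵗ)` with the covolume of the cycle lattice. -/

/-- Stack `Kᵗ` over `M` to get a square matrix `Q`, and let `P = (K | L)`, which is unimodular.
Since `M K = 0`, `Q Qᵗ` is block diagonal and `Q P` block triangular; comparing `det(Q)²` in both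
gives the claim. -/
theorem Matrix.det_mul_transpose_eq_of_fromCols {n ι κ : Type*} [Fintype n] [Fintype ι]
    [Fintype κ] [DecidableEq n] [DecidableEq ι] [DecidableEq κ] (K : Matrix n ι ℤ)
    (L : Matrix n κ ℤ) (M : Matrix κ n ℤ) (hMK : M * K = 0) (f : ι ⊕ κ ≃ n)
    (hP : IsUnit ((fromCols K L).submatrix f id).det) (hK : (Kᵀ * K).det ≠ 0) :
    (M * Mᵀ).det = (M * L).det ^ 2 * (Kᵀ * K).det := by
  set Q := (fromRows Kᵀ M).submatrix id f with hQ
  set P := (fromCols K L).submatrix f id with hP'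
  have h1 : Q * Qᵀ = fromBlocks (Kᵀ * K) 0 0 (M * Mᵀ) := by
    have h0 : Kᵀ * Mᵀ = 0 := by rw [← transpose_mul, hMK, transpose_zero]
    rw [hQ, transpose_submatrix, submatrix_mul_equiv, transpose_fromRows, transpose_transpose,
      fromRows_mul_fromCols, hMK, h0, submatrix_id_id]
  have h2 : Q * P = fromBlocks (Kᵀ * K) (Kᵀ * L) 0 (M * L) := by
    rw [hQ, hP', submatrix_mul_equiv, fromRows_mul_fromCols, hMK, submatrix_id_id]
  have h3 : Q.det ^ 2 = (Kᵀ * K).det * (M * Mᵀ).det := by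
    rw [← det_fromBlocks_zero₂₁, ← h1, det_mul, det_transpose, sq]
  have h4 : Q.det * P.det = (Kᵀ * K).det * (M * L).det := by
    rw [← det_mul, h2, det_fromBlocks_zero₂₁]
  have h5 : P.det ^ 2 = 1 := by rw [Int.isUnit_iff] at hP; rcases hP with h | h <;> simp [h]
  apply mul_left_cancel₀ hK
  rw [← h3]
  linear_combination (Q.det * P.det + (Kᵀ * K).det * (M * L).det) * h4 - Q.det ^ 2 * h5

namespace FiniteComplex

variable (X : FiniteComplex.{u}) (i : ℕ)

theorem card_redHomology_eq {r : ℕ} (Z' : Module.Basis (Fin r) ℤ (X.cycles i))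
    (β : Module.Basis (Fin r) ℤ ((X.boundaries i).submoduleOf (X.cycles i))) :
    (Z'.det ((↑) ∘ β)).natAbs = Nat.card (X.RedHomology i) :=
  Submodule.natAbs_det_basis_change Z' _ β

theorem nonempty_basis_boundaries (h : Module.finrank ℤ (X.RedHomology i) = 0) {r : ℕ}
    (Z' : Module.Basis (Fin r) ℤ (X.cycles i)) :
    Nonempty (Module.Basis (Fin r) ℤ ((X.boundaries i).submoduleOf (X.cycles i))) := by
  refine ⟨Module.finBasisOfFinrankEq ℤ _ ?_⟩
  have h1 := Submodule.finrank_quotient_add_finrank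
    ((X.boundaries i).submoduleOf (X.cycles i))
  rw [Module.finrank_eq_card_basis Z', Fintype.card_fin] at h1
  change Module.finrank ℤ (X.RedHomology i) + _ = r at h1
  omega

/-- Lifts `x j` of a basis `β` of `B_{i-1}` complete `Z` to a basis of `C_i`. On the lifts, `M`
becomes the matrix of `β` in `Z'`, whose determinant is, up to sign, the index `[Z_{i-1} :
B_{i-1}]`. The rank condition makes that index finite. -/
theorem det_bdCoord_mul_transpose (h : Module.finrank ℤ (X.RedHomology i) = 0) {r k : ℕ}
    (Z' : Module.Basis (Fin r) ℤ (X.cycles i))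
    (Z : Module.Basis (Fin k) ℤ (X.cycles (i + 1))) :
    (X.bdCoord i Z' * (X.bdCoord i Z')ᵀ).det =
        (Nat.card (X.RedHomology i) : ℤ) ^ 2 * gramDet Z ∧
      (Nat.card (X.RedHomology i) : ℤ) ≠ 0 := by
  obtain ⟨β⟩ := X.nonempty_basis_boundaries i h Z'
  have hex : ∀ j, ∃ x, X.D (i + 1) *ᵥ x = ((β j : X.cycles i) : X.Gen (i + 1) → ℤ) :=
    fun j => (β j).2
  choose x hx using hex
  let v : Fin k ⊕ Fin r → X.Gen (i + 2) → ℤ := Sum.elim (fun a => (Z a : X.Gen (i + 2) → ℤ)) x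
  let ψ := (X.D (i + 1)).mulVecLin
  have hβinj : ∀ c : Fin r → ℤ, ψ (∑ j, c j • x j) =
      (((∑ j, c j • β j : (X.boundaries i).submoduleOf (X.cycles i)) : X.cycles i) :
        X.Gen (i + 1) → ℤ) := by
    intro c
    simp only [map_sum, map_smul, Submodule.coe_sum, Submodule.coe_smul]
    exact Finset.sum_congr rfl fun j _ => congrArg _ (hx j)
  have hZψ : ∀ z : X.cycles (i + 1), ψ z = 0 := fun z => z.2
  have hli : LinearIndependent ℤ v := by
    rw [Fintype.linearIndependent_iff]
    intro c hc
    rw [Fintype.sum_sum_type] at hc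
    have h1 : (∑ a, c (Sum.inl a) • v (Sum.inl a)) =
        ((∑ a, c (Sum.inl a) • Z a : X.cycles (i + 1)) : X.Gen (i + 2) → ℤ) := by
      simp [v]
    have h2 : ∀ j, c (Sum.inr j) = 0 := by
      have h3 := congrArg ψ hc
      rw [map_add, h1, hZψ, zero_add, map_zero] at h3
      have h4 := (hβinj fun j => c (Sum.inr j)).symm.trans h3
      exact Fintype.linearIndependent_iff.1 β.linearIndependent _
        (Subtype.ext (Subtype.ext h4))
    rintro (a | j)
    · rw [h1] at hc
      simp only [h2, zero_smul, Finset.sum_const_zero, add_zero] at hc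
      exact Fintype.linearIndependent_iff.1 Z.linearIndependent _ (Subtype.ext hc) a
    · exact h2 j
  have hsp : ⊤ ≤ Submodule.span ℤ (Set.range v) := by
    intro y _
    let c := β.repr ⟨⟨ψ y, X.boundaries_le_cycles i ⟨y, rfl⟩⟩, ⟨y, rfl⟩⟩
    -- Subtracting the lift of `∂y` from `y` leaves a cycle.
    have h1 : ψ (y - ∑ j, c j • x j) = 0 := by
      rw [map_sub, hβinj, β.sum_repr, sub_self]
    have h2 : ∑ a, ((Z.repr ⟨_, h1⟩ a • Z a : X.cycles (i + 1)) : X.Gen (i + 2) → ℤ) =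
        y - ∑ j, c j • x j := by
      rw [← Submodule.coe_sum, Z.sum_repr]
    rw [← sub_add_cancel y (∑ j, c j • x j), ← h2]
    refine add_mem (sum_mem fun a _ => ?_) (sum_mem fun j _ => ?_)
    · exact Submodule.smul_mem _ _ (Submodule.subset_span ⟨Sum.inl a, rfl⟩)
    · exact Submodule.smul_mem _ _ (Submodule.subset_span ⟨Sum.inr j, rfl⟩)
  let b := Module.Basis.mk hli hsp
  -- Both are bases of `C_i`, so their index types match and the matrix `(K | L)` is square.
  let f := b.indexEquiv (Pi.basisFun ℤ (X.Gen (i + 2)))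
  let K : Matrix (X.Gen (i + 2)) (Fin k) ℤ := (Matrix.of fun a => (Z a : X.Gen (i + 2) → ℤ))ᵀ
  let L : Matrix (X.Gen (i + 2)) (Fin r) ℤ := (Matrix.of x)ᵀ
  have hP : IsUnit ((fromCols K L).submatrix f id).det := by
    have h1 := ((Pi.basisFun ℤ (X.Gen (i + 2))).reindex f.symm).isUnit_det b
    have h2 : (fromCols K L).submatrix f id =
        ((Pi.basisFun ℤ (X.Gen (i + 2))).reindex f.symm).toMatrix b := by
      ext p q
      rcases q with q | q <;> simp [Module.Basis.toMatrix_apply, b, v, K, L]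
    rwa [Module.Basis.det_apply, ← h2] at h1
  have hMK : X.bdCoord i Z' * K = 0 := by
    ext p a
    exact congrFun (X.bdCoord_mulVec_cycle i Z' (Z a)) p
  have hML : X.bdCoord i Z' * L = Z'.toMatrix ((↑) ∘ β) := by
    ext p j
    refine (congrFun (X.bdCoord_mulVec i Z' (x j)) p).trans ?_
    rw [Module.Basis.toMatrix_apply, Module.Basis.equivFun_apply]
    exact congrArg (fun y => Z'.repr y p) (Subtype.ext (hx j))
  have hG : gramDet Z = (Kᵀ * K).det := rfl
  have hcard := X.card_redHomology_eq i Z' β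
  have hsq : (Nat.card (X.RedHomology i) : ℤ) ^ 2 = (X.bdCoord i Z' * L).det ^ 2 := by
    rw [← hcard, Int.natAbs_sq, Module.Basis.det_apply, hML]
  constructor
  · rw [hsq, hG]
    exact det_mul_transpose_eq_of_fromCols K L _ hMK f hP
      (hG ▸ gramDet_ne_zero Z.linearIndependent)
  · rw [← hcard, Int.natCast_ne_zero, Int.natAbs_ne_zero, Module.Basis.det_apply]
    exact det_ne_zero_of_linearIndependent_cols
      ((β.linearIndependent.map' _ (Submodule.ker_subtype _)).map' Z'.equivFun.toLinearMap
        Z'.equivFun.ker)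

end FiniteComplex

theorem Matrix.finrank_ker_add_rank_int {m n : Type*} [Fintype m] [Fintype n] (A : Matrix m n ℤ) :
    Module.finrank ℤ (LinearMap.ker A.mulVecLin) + A.rank = Fintype.card n := by
  have h1 := Submodule.finrank_quotient_add_finrank (LinearMap.ker A.mulVecLin)
  rw [A.mulVecLin.quotKerEquivRange.finrank_eq, Module.finrank_fintype_fun_eq_card] at h1
  rw [Matrix.rank]
  omega

/-! ### The dual tree number as a Gram determinant. -/

namespace FiniteComplex

variable (X : FiniteComplex.{u}) (i : ℕ)

theorem finrank_boundaries_eq (n : ℕ) (h : Module.finrank ℤ (X.RedHomology n) = 0) :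
    Module.finrank ℤ (X.boundaries n) = Module.finrank ℤ (X.cycles n) := by
  have h1 := Submodule.finrank_quotient_add_finrank
    ((X.boundaries n).submoduleOf (X.cycles n))
  rw [(Submodule.submoduleOfEquivOfLe (X.boundaries_le_cycles n)).finrank_eq] at h1
  change Module.finrank ℤ (X.RedHomology n) + _ = _ at h1
  omega

/-- Rank–nullity for `∂_{i+2}ᵗ` and `∂_{i+1}`, together with rational exactness at `C_{i+1}`, gives
`rk Z^{i+1} = rk ∂_{i+1}`. -/
theorem finrank_cocycles_eq (h : Module.finrank ℤ (X.RedHomology (i + 2)) = 0) :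
    Module.finrank ℤ (X.cocycles (i + 2)) = Module.finrank ℤ (X.boundaries (i + 1)) := by
  have h1 := finrank_ker_add_rank_int (X.D (i + 3))ᵀ
  have h2 := finrank_ker_add_rank_int (X.D (i + 2))
  have h3 := X.finrank_boundaries_eq (i + 2) h
  rw [rank_transpose_int] at h1
  change _ = Module.finrank ℤ (LinearMap.ker (X.D (i + 2)).mulVecLin) at h3
  change (X.D (i + 3)).rank = _ at h3
  change _ = (X.D (i + 2)).rank
  change Module.finrank ℤ (X.cocycles (i + 2)) + _ = _ at h1
  change _ = Fintype.card (X.Gen (i + 3)) at h2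
  omega

/-- Transposing the expansion of `δ_i` in `W` gives `∂_{i+1} x = ∑ (W_a ∘ x) N_a`, so the rows `N_a`
span `B_i` once they are known to be boundaries. Their number is `rk B_i`, so they form a basis, and
Gram determinants do not depend on the basis. -/
theorem dualTreeNumber_eq_gramDet (h : Module.finrank ℤ (X.RedHomology (i + 2)) = 0) {s t : ℕ}
    (B : Module.Basis (Fin s) ℤ (X.boundaries (i + 1)))
    (W : Module.Basis (Fin t) ℤ (X.cocycles (i + 2))) :
    X.dualTreeNumber i W = gramDet B := by
  obtain rfl : t = s := by
    have := X.finrank_cocycles_eq i h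
    rwa [Module.finrank_eq_card_basis B, Module.finrank_eq_card_basis W, Fintype.card_fin,
      Fintype.card_fin] at this
  set N := X.cobdCoord i W with hN
  have hD : ∀ x σ, (X.D (i + 2) *ᵥ x) σ =
      ∑ a, ((W a : X.Gen (i + 3) → ℤ) ⬝ᵥ x) * N a σ := by
    intro x σ
    have h1 : X.D (i + 2) σ = ∑ a, N a σ • (W a : X.Gen (i + 3) → ℤ) := by
      have h2 := congrArg Subtype.val (W.sum_repr (X.cobdCocycle i σ))
      rw [Submodule.coe_sum] at h2
      refine Eq.trans ?_ h2.symm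
      ext c
      simp [cobdCocycle]
    rw [mulVec, h1, sum_dotProduct]
    exact Finset.sum_congr rfl fun a _ => by rw [smul_dotProduct, smul_eq_mul, mul_comm]
  have hmem : ∀ a, N a ∈ X.boundaries (i + 1) := by
    intro a
    -- A chain `x` with `W_b ∘ x = δ_{ab}`; its boundary is the row `N a`.
    obtain ⟨x, hx⟩ := exists_extend_ker _ (W.coord a)
    refine ⟨x, ?_⟩
    ext σ
    rw [mulVecLin_apply, hD, Finset.sum_eq_single a]
    · rw [dotProduct_comm, ← hx, Module.Basis.coord_apply, Module.Basis.repr_self,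
        Finsupp.single_eq_same, one_mul]
    · intro b _ hb
      rw [dotProduct_comm, ← hx, Module.Basis.coord_apply, Module.Basis.repr_self,
        Finsupp.single_eq_of_ne hb.symm, zero_mul]
    · simp
  let v : Fin t → X.boundaries (i + 1) := fun a => ⟨N a, hmem a⟩
  have hspan : ∀ y : X.boundaries (i + 1), ∃ c : Fin t → ℤ, y = ∑ a, c a • v a := by
    rintro ⟨y, x, rfl⟩
    refine ⟨fun a => (W a : X.Gen (i + 3) → ℤ) ⬝ᵥ x, Subtype.ext ?_⟩
    ext σ
    rw [Submodule.coe_sum, Finset.sum_apply]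
    exact hD x σ
  choose c hc using fun j => hspan (B j)
  -- Spanning yields an integral right inverse, so the change of basis is unimodular.
  have hmul : B.toMatrix v * (Matrix.of c)ᵀ = 1 := by
    ext p j
    have h1 := congrArg (fun y => B.repr y p) (hc j)
    simp only [Module.Basis.repr_self, map_sum, map_smul, Finsupp.coe_finsetSum,
      Finset.sum_apply, Finsupp.coe_smul, Pi.smul_apply, smul_eq_mul] at h1
    rw [mul_apply, one_apply]
    rw [Finsupp.single_apply] at h1
    simp only [eq_comm (a := p)]
    rw [h1]
    exact Finset.sum_congr rfl fun a _ => mul_comm _ _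
  have hdet : B.det v ^ 2 = 1 := by
    have h1 : IsUnit (B.det v) := by
      rw [Module.Basis.det_apply]
      exact IsUnit.of_mul_eq_one _ (by rw [← det_mul, hmul, det_one])
    rw [Int.isUnit_iff] at h1
    rcases h1 with h1 | h1 <;> simp [h1]
  have h1 : X.dualTreeNumber i W = gramDet v := rfl
  rw [h1, gramDet_eq_det_sq_mul B, hdet, one_mul]

/-! ### Spanning trees and maximal minors. -/

/-- The inclusion of `Z_{i-1}(X)` into the rational chains. -/
def ratCycle : X.cycles i →ₗ[ℤ] (X.Gen (i + 1) → ℚ) :=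
  (Algebra.linearMap ℤ ℚ).compLeft (X.Gen (i + 1)) ∘ₗ (X.cycles i).subtype

theorem ratCycle_ker : LinearMap.ker (X.ratCycle i) = ⊥ := by
  rw [LinearMap.ker_eq_bot']
  intro z hz
  apply Subtype.ext
  ext τ
  have h := congrFun hz τ
  simpa [ratCycle] using h

theorem ratCycle_bdCycle (σ : X.Gen (i + 2)) : X.ratCycle i (X.bdCycle i σ) = X.ratCol i σ := by
  ext τ
  simp [ratCycle, bdCycle, ratCol]

theorem linearIndependent_ratCol_iff {κ : Type*} (g : κ → X.Gen (i + 2)) :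
    LinearIndependent ℚ (fun j => X.ratCol i (g j)) ↔
      LinearIndependent ℤ fun j => X.bdCycle i (g j) := by
  rw [← LinearIndependent.iff_fractionRing ℤ ℚ,
    ← (X.ratCycle i).linearIndependent_iff (X.ratCycle_ker i)]
  simp only [Function.comp_def, ratCycle_bdCycle]

theorem linearIndependent_bdCycle_iff {r : ℕ} (Z' : Module.Basis (Fin r) ℤ (X.cycles i))
    (g : Fin r → X.Gen (i + 2)) :
    LinearIndependent ℤ (fun j => X.bdCycle i (g j)) ↔
      ((X.bdCoord i Z').submatrix id g).det ≠ 0 := by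
  have h : ((X.bdCoord i Z').submatrix id g).col =
      Z'.equivFun.toLinearMap ∘ fun j => X.bdCycle i (g j) := rfl
  rw [← Z'.equivFun.toLinearMap.linearIndependent_iff Z'.equivFun.ker, ← h]
  exact ⟨det_ne_zero_of_linearIndependent_cols, linearIndependent_cols_of_det_ne_zero⟩

/-- Cramer's rule: `det A` times any column of `∂_i` is an integral combination of the chosen ones,
and `det A` is invertible over `ℚ`. -/
theorem ratCol_mem_span {r : ℕ} (Z' : Module.Basis (Fin r) ℤ (X.cycles i))
    (g : Fin r → X.Gen (i + 2)) (hg : ((X.bdCoord i Z').submatrix id g).det ≠ 0)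
    (σ : X.Gen (i + 2)) :
    X.ratCol i σ ∈ Submodule.span ℚ (Set.range fun j => X.ratCol i (g j)) := by
  set A := (X.bdCoord i Z').submatrix id g with hA
  have h1 : A.det • X.bdCycle i σ =
      ∑ j, (A.adjugate *ᵥ (X.bdCoord i Z').col σ) j • X.bdCycle i (g j) := by
    apply Z'.equivFun.injective
    have h2 : A *ᵥ (A.adjugate *ᵥ (X.bdCoord i Z').col σ) =
        A.det • Z'.equivFun (X.bdCycle i σ) := by
      rw [mulVec_mulVec, mul_adjugate, smul_mulVec, one_mulVec]
      rfl
    rw [map_smul, ← h2, map_sum]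
    ext a
    rw [mulVec, dotProduct, Finset.sum_apply]
    exact Finset.sum_congr rfl fun j _ => by
      rw [map_smul, Pi.smul_apply, smul_eq_mul, mul_comm]; rfl
  have h3 := congrArg (X.ratCycle i) h1
  simp only [map_smul, map_sum, ratCycle_bdCycle] at h3
  have h4 : (A.det : ℚ) • X.ratCol i σ ∈
      Submodule.span ℚ (Set.range fun j => X.ratCol i (g j)) := by
    rw [Int.cast_smul_eq_zsmul, h3]
    refine sum_mem fun j _ => ?_
    rw [← Int.cast_smul_eq_zsmul ℚ]
    exact Submodule.smul_mem _ _ (Submodule.subset_span ⟨j, rfl⟩)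
  exact (Submodule.smul_mem_iff _ (Int.cast_ne_zero.2 hg)).1 h4

theorem range_ratCol_equiv {r : ℕ} {I : Finset (X.Gen (i + 2))} (e : Fin r ≃ I) :
    (Set.range fun j => X.ratCol i (e j)) = X.ratCol i '' (I : Set (X.Gen (i + 2))) := by
  have h : (fun j => X.ratCol i (e j)) = (fun σ : I => X.ratCol i σ) ∘ e := rfl
  rw [h, e.surjective.range_comp, Set.image_eq_range]
  rfl

theorem isSpanningTree_of_det_ne_zero {r : ℕ} (Z' : Module.Basis (Fin r) ℤ (X.cycles i))
    {I : Finset (X.Gen (i + 2))} (e : Fin r ≃ I)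
    (hdet : ((X.bdCoord i Z').submatrix id fun j => (e j : X.Gen (i + 2))).det ≠ 0) :
    X.IsSpanningTree i I := by
  refine ⟨?_, le_antisymm (Submodule.span_mono (Set.image_subset_range _ _)) ?_⟩
  · rw [← linearIndependent_equiv e]
    exact (X.linearIndependent_ratCol_iff i _).2
      ((X.linearIndependent_bdCycle_iff i Z' _).2 hdet)
  · rw [Submodule.span_le, ← X.range_ratCol_equiv i e]
    rintro _ ⟨σ, rfl⟩
    exact X.ratCol_mem_span i Z' _ hdet σ

theorem IsSpanningTree.det_ne_zero {X : FiniteComplex.{u}} {i r : ℕ}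
    (Z' : Module.Basis (Fin r) ℤ (X.cycles i))
    {I : Finset (X.Gen (i + 2))} (hI : X.IsSpanningTree i I) (e : Fin r ≃ I) :
    ((X.bdCoord i Z').submatrix id fun j => (e j : X.Gen (i + 2))).det ≠ 0 := by
  rw [← X.linearIndependent_bdCycle_iff i Z', ← linearIndependent_ratCol_iff]
  exact (linearIndependent_equiv e).2 hI.1

theorem IsSpanningTree.card_eq {X : FiniteComplex.{u}} {i : ℕ} {I : Finset (X.Gen (i + 2))}
    (hI : X.IsSpanningTree i I) :
    I.card = Module.finrank ℚ (Submodule.span ℚ (Set.range (X.ratCol i))) := by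
  rw [← hI.2, Set.image_eq_range]
  exact ((finrank_span_eq_card hI.1).trans (Fintype.card_coe I)).symm

/-- The boundaries of the cells of `I` form a basis of the boundary lattice of `X_I`, so the minor
is, up to sign, the index of that lattice in `Z_{i-1}`. -/
theorem weight_eq_natAbs_det {r : ℕ} (Z' : Module.Basis (Fin r) ℤ (X.cycles i))
    {I : Finset (X.Gen (i + 2))} (e : Fin r ≃ I)
    (hdet : ((X.bdCoord i Z').submatrix id fun j => (e j : X.Gen (i + 2))).det ≠ 0) :
    X.weight i I =
      ((X.bdCoord i Z').submatrix id fun j => (e j : X.Gen (i + 2))).det.natAbs := by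
  let N := (LinearMap.range (X.bdRestrict i I).mulVecLin).submoduleOf (X.cycles i)
  have hcol : ∀ c : I → ℤ, ((∑ j, c (e j) • X.bdCycle i (e j) : X.cycles i) :
      X.Gen (i + 1) → ℤ) = X.bdRestrict i I *ᵥ c := by
    intro c
    rw [e.sum_comp fun σ : I => c σ • X.bdCycle i (σ : X.Gen (i + 2))]
    ext τ
    simp [bdCycle, bdRestrict, mulVec, dotProduct, mul_comm]
  have hmem : ∀ j, X.bdCycle i (e j) ∈ N := by
    intro j
    refine ⟨Pi.single (e j) 1, ?_⟩
    ext τ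
    simp [bdCycle, bdRestrict]
  let v : Fin r → N := fun j => ⟨X.bdCycle i (e j), hmem j⟩
  have hli : LinearIndependent ℤ v := by
    refine LinearIndependent.of_comp N.subtype ?_
    exact (X.linearIndependent_bdCycle_iff i Z' _).2 hdet
  have hsp : ⊤ ≤ Submodule.span ℤ (Set.range v) := by
    rintro ⟨y, c, hc⟩ _
    have h : (⟨y, c, hc⟩ : N) = ∑ j, c (e j) • v j := by
      apply Subtype.ext
      apply Subtype.ext
      refine hc.symm.trans ((hcol c).symm.trans ?_)
      simp [v]
    rw [h]
    exact sum_mem fun j _ => Submodule.smul_mem _ _ (Submodule.subset_span ⟨j, rfl⟩)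
  have h := Submodule.natAbs_det_basis_change Z' N (Module.Basis.mk hli hsp)
  rw [Module.Basis.coe_mk] at h
  exact h.symm

theorem treeNumber_eq_det {r : ℕ} (Z' : Module.Basis (Fin r) ℤ (X.cycles i))
    (h0 : (X.bdCoord i Z' * (X.bdCoord i Z')ᵀ).det ≠ 0) :
    (X.treeNumber i : ℤ) = (X.bdCoord i Z' * (X.bdCoord i Z')ᵀ).det := by
  classical
  let e : ∀ U : {U : Finset (X.Gen (i + 2)) // U.card = r}, Fin r ≃ U.1 :=
    fun U => (U.1.equivFinOfCardEq U.2).symm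
  have hcb := cauchyBinet e (X.bdCoord i Z') (X.bdCoord i Z')
  -- A nonzero determinant forces a nonzero `r × r` minor, so the rational column rank is exactly
  -- `r` and every spanning tree has `r` cells.
  have hr : Module.finrank ℚ (Submodule.span ℚ (Set.range (X.ratCol i))) = r := by
    rw [hcb] at h0
    obtain ⟨U, _, hU⟩ := Finset.exists_ne_zero_of_sum_ne_zero h0
    rw [← U.2, (X.isSpanningTree_of_det_ne_zero i Z' (e U) (left_ne_zero_of_mul hU)).card_eq]
  rw [hcb, treeNumber, Nat.cast_sum]
  symm
  refine Finset.sum_bij_ne_zero (fun U _ _ => U.1) ?_ ?_ ?_ ?_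
  · intro U _ hU
    rw [Finset.mem_filter]
    exact ⟨Finset.mem_univ _,
      X.isSpanningTree_of_det_ne_zero i Z' (e U) (left_ne_zero_of_mul hU)⟩
  · intro U _ _ V _ _ h
    exact Subtype.ext h
  · intro I hI _
    rw [Finset.mem_filter] at hI
    have hcard : I.card = r := hI.2.card_eq.trans hr
    have hne := hI.2.det_ne_zero Z' (e ⟨I, hcard⟩)
    exact ⟨⟨I, hcard⟩, Finset.mem_univ _, mul_ne_zero hne hne, rfl⟩
  · intro U _ hU
    rw [X.weight_eq_natAbs_det i Z' (e U) (left_ne_zero_of_mul hU), Nat.cast_pow,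
      Int.natAbs_sq, sq]

end FiniteComplex

theorem mainTheorem10 (X : FiniteComplex.{u}) (i : ℕ) (hX : X.UnicycleCondition i)
    {r s t : ℕ}
    (Z' : Module.Basis (Fin r) ℤ (X.cycles i))
    (e : ∀ U : X.Cycletree i, Fin (r + 1) ≃ U.1)
    (Z : Module.Basis (Fin (s + 1)) ℤ (X.cycles (i + 1)))
    (B : Module.Basis (Fin s) ℤ (X.boundaries (i + 1)))
    (W : Module.Basis (Fin t) ℤ (X.cocycles (i + 2))) :
    X.normalizedHarmonicCycle i Z' e Z B ⬝ᵥ X.normalizedHarmonicCycle i Z' e Z B =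
      (X.treeNumber i : ℚ) * (X.dualTreeNumber i W : ℚ) := by
  obtain ⟨hd, hh⟩ := X.det_bdCoord_mul_transpose i hX.2.2 Z' Z
  have hd0 : (X.bdCoord i Z' * (X.bdCoord i Z')ᵀ).det ≠ 0 := by
    rw [hd]
    exact mul_ne_zero (pow_ne_zero 2 hh) (gramDet_ne_zero Z.linearIndependent)
  have hself := X.standardHarmonicCycle_dotProduct_self i Z' e Z B _ hd hh
  rw [← X.treeNumber_eq_det i Z' hd0, ← X.dualTreeNumber_eq_gramDet i hX.1 B W] at hself
  have hq := congrArg (Int.cast : ℤ → ℚ) hself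
  have hhq : (Nat.card (X.RedHomology i) : ℚ) ≠ 0 := by exact_mod_cast hh
  have hsum : X.normalizedHarmonicCycle i Z' e Z B ⬝ᵥ X.normalizedHarmonicCycle i Z' e Z B =
      (((X.standardHarmonicCycle i Z' e Z B : X.Gen (i + 2) → ℤ) ⬝ᵥ
        (X.standardHarmonicCycle i Z' e Z B : X.Gen (i + 2) → ℤ) : ℤ) : ℚ) /
        (Nat.card (X.RedHomology i) : ℚ) ^ 2 := by
    rw [dotProduct, dotProduct, Int.cast_sum, Finset.sum_div]
    refine Finset.sum_congr rfl fun σ _ => ?_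
    rw [FiniteComplex.normalizedHarmonicCycle, div_mul_div_comm, Int.cast_mul, sq]
  rw [hsum, hq]
  push_cast
  field_simp
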